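/- Let $d=1$ and let $V:\mathbb{R}\to\mathbb{R}$ be a Borel measurable function. For $t>0$ and $x,y\in\mathbb{R}$ put $$g(t,x,y)=(4\pi t)^{-1/2}e^{-\frac{|y-x|^2}{4t}},\qquad S(V,t,x,y)=\int_0^t\int_{\mathbb{R}}\frac{g(s,x,z)\,g(t-s,z,y)}{g(t,x,y)}\,|V(z)|\,dz\,ds,$$ and for $T>0$ let $\|S(V)\|_{T,\infty}=\sup_{0<t\le T}\ \sup_{x,y\in\mathbb{R}}S(V,t,x,y)\in[0,\infty]$. Then the following conditions are equivalent: a) $V$ belongs to the Kato class $\mathcal{K}_1$, i.e. $\displaystyle\lim_{t\to0^+}\sup_{x\in\mathbb{R}}\int_0^t\int_{\mathbb{R}}g(s,x,z)|V(z)|\,dz\,ds=0$; b) $V$ belongs to the enlarged Kato class $\widehat{\mathcal{K}}_1$, i.e. $\displaystyle\sup_{x\in\mathbb{R}}\int_0^t\int_{\mathbb{R}}g(s,x,z)|V(z)|\,dz\,ds<\infty$ for some (equivalently, for every) $t>0$; c) $\displaystyle\sup_{x\in\mathbb{R}}\int_{|z-x|\le1}|V(z)|\,dz<\infty$; d) $\displaystyle\lim_{T\to0^+}\|S(V)\|_{T,\infty}=0$;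 e) $\|S(V)\|_{T,\infty}<\infty$ for some (equivalently, for every) $T>0$. -/

import Mathlib

open MeasureTheory Set Filter Topology
open scoped ENNReal

namespace SharpGauss

noncomputable section

/-- The Gauss-Weierstrass kernel on the real line,
`g(t,x,y) = (4πt)^{-1/2} exp(-|y-x|²/(4t))`, for `t > 0`. -/
def gauss (t x y : ℝ) : ℝ :=
  (4 * Real.pi * t) ^ (-(1 / 2) : ℝ) * Real.exp (-|y - x| ^ 2 / (4 * t))

/-- `S(V,t,x,y) = ∫₀ᵗ ∫ g(s,x,z) g(t-s,z,y) / g(t,x,y) |V(z)| dz ds`, with values in `[0,∞]`. -/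
def S (V : ℝ → ℝ) (t x y : ℝ) : ℝ≥0∞ :=
  ∫⁻ s in Ioo 0 t, ∫⁻ z,
    ENNReal.ofReal (gauss s x z * gauss (t - s) z y / gauss t x y * |V z|)

/-- `‖S(V,t)‖_∞ = sup_{x,y} S(V,t,x,y)`. -/
def normSAt (V : ℝ → ℝ) (t : ℝ) : ℝ≥0∞ := ⨆ x : ℝ, ⨆ y : ℝ, S V t x y

/-- `‖S(V)‖_{T,∞} = sup_{0 < t ≤ T} ‖S(V,t)‖_∞`. -/
def normS (V : ℝ → ℝ) (T : ℝ) : ℝ≥0∞ := ⨆ t ∈ Ioc 0 T, normSAt V t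

/-- `sup_x ∫₀ᵗ ∫ g(s,x,z) |V(z)| dz ds`, with values in `[0,∞]`. -/
def katoSup (V : ℝ → ℝ) (t : ℝ) : ℝ≥0∞ :=
  ⨆ x : ℝ, ∫⁻ s in Ioo 0 t, ∫⁻ z, ENNReal.ofReal (gauss s x z * |V z|)

/-- The Kato class in dimension one. -/
def KatoClass (V : ℝ → ℝ) : Prop :=
  Tendsto (fun t : ℝ => katoSup V t) (𝓝[>] 0) (𝓝 0)

/-- The enlarged Kato class in dimension one, with the condition required for some time. -/
def EnlargedKatoClass (V : ℝ → ℝ) : Prop :=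
  ∃ t : ℝ, 0 < t ∧ katoSup V t < ∞

end

end SharpGauss

namespace SharpGauss

/-! Every condition is compared with finiteness of `locNorm V`. By `gauss_bridge` the kernel
quotient in `S` is a single Gauss kernel of time `s(t-s)/t`, so `S` and the Kato integral are both
time integrals of `heat V`. Upper bounds: `heat_le` gives `heat V u m ≤ u^(-1/2) * heatConst V T`
uniformly in `m`. The singularity is integrable in time, even for the bridge time
(`rpow_neg_half_bridge_le`), so both quantities are `O(√t)`. Lower bounds: for times in a compact
subset of `(0,∞)` the kernel is bounded below on unit neighbourhoods of its centre (`le_gauss`), so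
a finite time integral controls `locNorm V`. -/

lemma gauss_eq (t x y : ℝ) :
    gauss t x y = (4 * Real.pi * t) ^ (-(1 / 2) : ℝ) * Real.exp (-(y - x) ^ 2 / (4 * t)) := by
  rw [gauss, sq_abs]

lemma gauss_pos {t : ℝ} (ht : 0 < t) (x y : ℝ) : 0 < gauss t x y := by
  rw [gauss_eq]; positivity

/-- The bridge of the Gauss kernel is a Gauss kernel. -/
lemma gauss_bridge {s t : ℝ} (hs : 0 < s) (hst : s < t) (x y z : ℝ) :
    gauss s x z * gauss (t - s) z y / gauss t x y
      = gauss (s * (t - s) / t) (x + s / t * (y - x)) z := by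
  have ht : 0 < t := hs.trans hst
  have hts : 0 < t - s := sub_pos.2 hst
  rw [div_eq_iff (gauss_pos ht x y).ne']
  simp only [gauss_eq]
  have hpow : (4 * Real.pi * s) ^ (-(1 / 2) : ℝ) * (4 * Real.pi * (t - s)) ^ (-(1 / 2) : ℝ)
      = (4 * Real.pi * (s * (t - s) / t)) ^ (-(1 / 2) : ℝ)
        * (4 * Real.pi * t) ^ (-(1 / 2) : ℝ) := by
    rw [← Real.mul_rpow (by positivity) (by positivity),
      ← Real.mul_rpow (by positivity) (by positivity)]
    congr 1
    field_simp
  have hexp : Real.exp (-(z - x) ^ 2 / (4 * s)) * Real.exp (-(y - z) ^ 2 / (4 * (t - s)))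
      = Real.exp (-(z - (x + s / t * (y - x))) ^ 2 / (4 * (s * (t - s) / t)))
        * Real.exp (-(y - x) ^ 2 / (4 * t)) := by
    rw [← Real.exp_add, ← Real.exp_add]
    congr 1
    field_simp
    ring
  rw [mul_mul_mul_comm, hpow, hexp, mul_mul_mul_comm]

/-- The heat semigroup applied to `|V|`, with values in `[0,∞]`. -/
noncomputable def heat (V : ℝ → ℝ) (u m : ℝ) : ℝ≥0∞ :=
  ∫⁻ z, ENNReal.ofReal (gauss u m z * |V z|)

/-- The supremum of the integrals of `|V|` over intervals of length two. -/
noncomputable def locNorm (V : ℝ → ℝ) : ℝ≥0∞ :=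
  ⨆ x : ℝ, ∫⁻ z in {z : ℝ | |z - x| ≤ 1}, ENNReal.ofReal |V z|

lemma S_eq_lintegral_heat (V : ℝ → ℝ) (t x y : ℝ) :
    S V t x y = ∫⁻ s in Ioo 0 t, heat V (s * (t - s) / t) (x + s / t * (y - x)) := by
  refine setLIntegral_congr_fun measurableSet_Ioo fun s hs => ?_
  simp only [heat, gauss_bridge hs.1 hs.2]

lemma katoSup_eq_iSup_heat (V : ℝ → ℝ) (t : ℝ) :
    katoSup V t = ⨆ x : ℝ, ∫⁻ s in Ioo 0 t, heat V s x := rfl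

/-! ### Upper bounds -/

/-- Moving `z` by at most 1 costs `(w - m)² ≤ 2(z - m)² + 2`: doubling the variance absorbs the
factor 2, and the prefactor absorbs the additive 2. Once the point value is an average, Tonelli can
shift the window onto `V`. -/
lemma exp_le_window_average {T : ℝ} (hT : 0 < T) (z m : ℝ) :
    ENNReal.ofReal (Real.exp (-(z - m) ^ 2 / (4 * T)))
      ≤ ENNReal.ofReal (Real.exp (1 / (4 * T)))
        * ∫⁻ w in {w : ℝ | |z - w| ≤ 1}, ENNReal.ofReal (Real.exp (-(w - m) ^ 2 / (8 * T))) := by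
  have hset : {w : ℝ | |z - w| ≤ 1} = Icc (z - 1) (z + 1) := by
    ext w
    simp only [mem_ofPred_eq, mem_Icc, abs_le]
    constructor <;> rintro ⟨h1, h2⟩ <;> constructor <;> linarith
  set b : ℝ := Real.exp (-((z - m) ^ 2 + 1) / (4 * T)) with hb
  have hlow : ENNReal.ofReal b
      ≤ ∫⁻ w in {w : ℝ | |z - w| ≤ 1}, ENNReal.ofReal (Real.exp (-(w - m) ^ 2 / (8 * T))) := by
    rw [hset]
    calc ENNReal.ofReal b = ENNReal.ofReal b * 1 := (mul_one _).symm
      _ ≤ ENNReal.ofReal b * volume (Icc (z - 1) (z + 1)) := by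
        gcongr
        rw [Real.volume_Icc, ← ENNReal.ofReal_one]
        exact ENNReal.ofReal_le_ofReal (by linarith)
      _ = ∫⁻ _ in Icc (z - 1) (z + 1), ENNReal.ofReal b := (setLIntegral_const _ _).symm
      _ ≤ _ := by
        refine setLIntegral_mono' measurableSet_Icc fun w hw => ENNReal.ofReal_le_ofReal ?_
        rw [hb, Real.exp_le_exp, div_le_div_iff₀ (by positivity) (by positivity)]
        have h1 : (w - z) ^ 2 ≤ 1 := by
          rw [sq_le_one_iff_abs_le_one, abs_le]
          constructor <;> linarith [hw.1, hw.2]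
        have h2 : (w - m) ^ 2 ≤ 2 * (z - m) ^ 2 + 2 := by
          nlinarith [sq_nonneg ((w - z) - (z - m))]
        nlinarith
  calc ENNReal.ofReal (Real.exp (-(z - m) ^ 2 / (4 * T)))
      = ENNReal.ofReal (Real.exp (1 / (4 * T))) * ENNReal.ofReal b := by
        rw [← ENNReal.ofReal_mul (Real.exp_pos _).le, hb, ← Real.exp_add]
        congr 2
        ring
    _ ≤ _ := by gcongr

lemma measurableSet_abs_sub_le_one : MeasurableSet {p : ℝ × ℝ | |p.1 - p.2| ≤ 1} :=
  measurableSet_le (by fun_prop) measurable_const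

/-- A locally uniformly integrable function integrated against the average of `h` over windows. -/
lemma lintegral_mul_window_le {V : ℝ → ℝ} (hV : Measurable V) {h : ℝ → ℝ≥0∞}
    (hh : Measurable h) :
    ∫⁻ z, ENNReal.ofReal |V z| * ∫⁻ w in {w : ℝ | |z - w| ≤ 1}, h w
      ≤ locNorm V * ∫⁻ w, h w := by
  set F : ℝ → ℝ → ℝ≥0∞ := fun z w =>
    {p : ℝ × ℝ | |p.1 - p.2| ≤ 1}.indicator (fun p => ENNReal.ofReal |V p.1| * h p.2) (z, w)
    with hF
  have hFm : Measurable (Function.uncurry F) := by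
    have : Measurable fun p : ℝ × ℝ => ENNReal.ofReal |V p.1| * h p.2 := by
      have hV' : Measurable fun p : ℝ × ℝ => |V p.1| :=
        (continuous_abs.measurable.comp hV).comp measurable_fst
      exact hV'.ennreal_ofReal.mul (hh.comp measurable_snd)
    exact this.indicator measurableSet_abs_sub_le_one
  have hz (z : ℝ) : MeasurableSet {w : ℝ | |z - w| ≤ 1} :=
    measurableSet_le (by fun_prop) measurable_const
  have hw (w : ℝ) : MeasurableSet {z : ℝ | |z - w| ≤ 1} :=
    measurableSet_le (by fun_prop) measurable_const
  calc ∫⁻ z, ENNReal.ofReal |V z| * ∫⁻ w in {w : ℝ | |z - w| ≤ 1}, h w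
      = ∫⁻ z, ∫⁻ w, F z w := by
        refine lintegral_congr fun z => ?_
        rw [← lintegral_const_mul _ hh, ← lintegral_indicator (hz z)]
        rfl
    -- The relation `|z - w| ≤ 1` is symmetric, so Tonelli turns windows around `z` into windows
    -- around `w`.
    _ = ∫⁻ w, ∫⁻ z, F z w := lintegral_lintegral_swap hFm.aemeasurable
    _ ≤ ∫⁻ w, locNorm V * h w := by
        refine lintegral_mono fun w => ?_
        have : ∫⁻ z, F z w = (∫⁻ z in {z : ℝ | |z - w| ≤ 1}, ENNReal.ofReal |V z|) * h w := by
          have hV' : Measurable fun z => ENNReal.ofReal |V z| :=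
            (continuous_abs.measurable.comp hV).ennreal_ofReal
          rw [← lintegral_mul_const _ hV', ← lintegral_indicator (hw w)]
          rfl
        rw [this]
        gcongr
        exact le_iSup (fun x : ℝ => ∫⁻ z in {z : ℝ | |z - x| ≤ 1}, ENNReal.ofReal |V z|) w
    _ = locNorm V * ∫⁻ w, h w := lintegral_const_mul _ hh

/-- The constant in the upper bound for `heat` up to time `T`. -/
noncomputable def heatConst (V : ℝ → ℝ) (T : ℝ) : ℝ≥0∞ :=
  ENNReal.ofReal (Real.exp (1 / (4 * T)))
    * (locNorm V * ∫⁻ w, ENNReal.ofReal (Real.exp (-(1 / (8 * T)) * w ^ 2)))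

lemma heatConst_lt_top {V : ℝ → ℝ} (h : locNorm V < ∞) {T : ℝ} (hT : 0 < T) :
    heatConst V T < ∞ := by
  refine ENNReal.mul_lt_top ENNReal.ofReal_lt_top (ENNReal.mul_lt_top h ?_)
  exact (integrable_exp_neg_mul_sq (by positivity : 0 < 1 / (8 * T))).lintegral_lt_top

lemma lintegral_exp_mul_le {V : ℝ → ℝ} (hV : Measurable V) {T : ℝ} (hT : 0 < T) (m : ℝ) :
    ∫⁻ z, ENNReal.ofReal (Real.exp (-(z - m) ^ 2 / (4 * T)) * |V z|) ≤ heatConst V T := by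
  set h : ℝ → ℝ≥0∞ := fun w => ENNReal.ofReal (Real.exp (-(w - m) ^ 2 / (8 * T))) with hh
  have hhm : Measurable h := by fun_prop
  have hshift : ∫⁻ w, h w = ∫⁻ w, ENNReal.ofReal (Real.exp (-(1 / (8 * T)) * w ^ 2)) := by
    rw [← lintegral_sub_right_eq_self
      (fun w => ENNReal.ofReal (Real.exp (-(1 / (8 * T)) * w ^ 2))) m]
    refine lintegral_congr fun w => ?_
    simp only [hh]
    congr 2
    ring
  calc ∫⁻ z, ENNReal.ofReal (Real.exp (-(z - m) ^ 2 / (4 * T)) * |V z|)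
      ≤ ∫⁻ z, ENNReal.ofReal (Real.exp (1 / (4 * T)))
          * (ENNReal.ofReal |V z| * ∫⁻ w in {w : ℝ | |z - w| ≤ 1}, h w) := by
        refine lintegral_mono fun z => ?_
        rw [ENNReal.ofReal_mul (Real.exp_pos _).le, mul_left_comm,
          mul_comm _ (ENNReal.ofReal |V z|)]
        gcongr
        exact exp_le_window_average hT z m
    _ = ENNReal.ofReal (Real.exp (1 / (4 * T)))
          * ∫⁻ z, ENNReal.ofReal |V z| * ∫⁻ w in {w : ℝ | |z - w| ≤ 1}, h w :=
        lintegral_const_mul' _ _ ENNReal.ofReal_ne_top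
    _ ≤ heatConst V T := by
        rw [heatConst, ← hshift]
        gcongr
        exact lintegral_mul_window_le hV hhm

/-- Only the exponential is relaxed to time `T`: the spatial integral then no longer depends on `u`,
and the prefactor keeps its integrable singularity. -/
lemma gauss_le {u T : ℝ} (hu : 0 < u) (huT : u ≤ T) (m z : ℝ) :
    gauss u m z ≤ u ^ (-(1 / 2) : ℝ) * Real.exp (-(z - m) ^ 2 / (4 * T)) := by
  rw [gauss_eq]
  gcongr ?_ * Real.exp ?_
  · refine Real.rpow_le_rpow_of_nonpos hu ?_ (by norm_num)
    nlinarith [Real.pi_gt_three]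
  · rw [neg_div, neg_div, neg_le_neg_iff]
    gcongr

lemma heat_le {V : ℝ → ℝ} (hV : Measurable V) {u T : ℝ} (hu : 0 < u) (huT : u ≤ T) (m : ℝ) :
    heat V u m ≤ ENNReal.ofReal (u ^ (-(1 / 2) : ℝ)) * heatConst V T := by
  calc heat V u m
      ≤ ∫⁻ z, ENNReal.ofReal (u ^ (-(1 / 2) : ℝ))
          * ENNReal.ofReal (Real.exp (-(z - m) ^ 2 / (4 * T)) * |V z|) := by
        refine lintegral_mono fun z => ?_
        rw [← ENNReal.ofReal_mul (by positivity), ← mul_assoc]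
        refine ENNReal.ofReal_le_ofReal ?_
        gcongr
        exact gauss_le hu huT m z
    _ = ENNReal.ofReal (u ^ (-(1 / 2) : ℝ))
          * ∫⁻ z, ENNReal.ofReal (Real.exp (-(z - m) ^ 2 / (4 * T)) * |V z|) :=
        lintegral_const_mul' _ _ ENNReal.ofReal_ne_top
    _ ≤ _ := by
        gcongr
        exact lintegral_exp_mul_le hV (hu.trans_le huT) m

/-- The inverse bridge time is `1/s + 1/(t-s)`, and the square root is subadditive. -/
lemma rpow_neg_half_bridge_le {s t : ℝ} (hs : 0 < s) (hst : s < t) :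
    (s * (t - s) / t) ^ (-(1 / 2) : ℝ) ≤ s ^ (-(1 / 2) : ℝ) + (t - s) ^ (-(1 / 2) : ℝ) := by
  have ht : 0 < t := hs.trans hst
  have hts : 0 < t - s := sub_pos.2 hst
  have hinv : (s * (t - s) / t)⁻¹ = s⁻¹ + (t - s)⁻¹ := by
    field_simp
    ring
  rw [Real.rpow_neg (by positivity), Real.rpow_neg hs.le, Real.rpow_neg hts.le,
    ← Real.inv_rpow (by positivity), ← Real.inv_rpow hs.le, ← Real.inv_rpow hts.le, hinv]
  exact Real.rpow_add_le_add_rpow (by positivity) (by positivity) (by norm_num) (by norm_num)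

lemma lintegral_rpow_neg_half_add {t : ℝ} (ht : 0 < t) :
    ∫⁻ s in Ioo 0 t, ENNReal.ofReal (s ^ (-(1 / 2) : ℝ) + (t - s) ^ (-(1 / 2) : ℝ))
      = ENNReal.ofReal (4 * t ^ (1 / 2 : ℝ)) := by
  have hi : IntervalIntegrable (fun s : ℝ => s ^ (-(1 / 2) : ℝ)) volume 0 t :=
    intervalIntegral.intervalIntegrable_rpow' (by norm_num)
  have hi' : IntervalIntegrable (fun s : ℝ => (t - s) ^ (-(1 / 2) : ℝ)) volume 0 t := by
    simpa using (hi.comp_sub_left t).symm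
  have hval : ∫ s in (0 : ℝ)..t, s ^ (-(1 / 2) : ℝ) = 2 * t ^ (1 / 2 : ℝ) := by
    rw [integral_rpow (Or.inl (by norm_num))]
    norm_num [Real.zero_rpow]
    ring
  have hval' : ∫ s in (0 : ℝ)..t, (t - s) ^ (-(1 / 2) : ℝ) = 2 * t ^ (1 / 2 : ℝ) := by
    rw [intervalIntegral.integral_comp_sub_left (fun s : ℝ => s ^ (-(1 / 2) : ℝ)) t]
    simpa using hval
  rw [← ofReal_integral_eq_lintegral_ofReal]
  · rw [← integral_Ioc_eq_integral_Ioo, ← intervalIntegral.integral_of_le ht.le,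
      intervalIntegral.integral_add hi hi', hval, hval']
    congr 1
    ring
  · have := (intervalIntegrable_iff_integrableOn_Ioo_of_le ht.le).1 (hi.add hi')
    exact this
  · refine (ae_restrict_iff' measurableSet_Ioo).2 (Eventually.of_forall fun s hs => ?_)
    have h1 : 0 < s := hs.1
    have h2 : 0 < t - s := sub_pos.2 hs.2
    exact (by positivity : (0 : ℝ) ≤ s ^ (-(1 / 2) : ℝ) + (t - s) ^ (-(1 / 2) : ℝ))

/-- Serves both `u s = s` and the bridge time; the centres `m s` are arbitrary because `heat_le` is
uniform in them. -/
lemma lintegral_heat_le {V : ℝ → ℝ} (hV : Measurable V) {t T : ℝ} (ht : 0 < t)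
    {u m : ℝ → ℝ} (hu : ∀ s ∈ Ioo 0 t, 0 < u s ∧ u s ≤ T ∧
      u s ^ (-(1 / 2) : ℝ) ≤ s ^ (-(1 / 2) : ℝ) + (t - s) ^ (-(1 / 2) : ℝ)) :
    ∫⁻ s in Ioo 0 t, heat V (u s) (m s)
      ≤ ENNReal.ofReal (4 * t ^ (1 / 2 : ℝ)) * heatConst V T := by
  calc ∫⁻ s in Ioo 0 t, heat V (u s) (m s)
      ≤ ∫⁻ s in Ioo 0 t, ENNReal.ofReal (s ^ (-(1 / 2) : ℝ) + (t - s) ^ (-(1 / 2) : ℝ))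
          * heatConst V T := by
        refine setLIntegral_mono' measurableSet_Ioo fun s hs => ?_
        obtain ⟨h1, h2, h3⟩ := hu s hs
        refine (heat_le hV h1 h2 (m s)).trans ?_
        gcongr
    _ = _ := by
        rw [lintegral_mul_const _ (by fun_prop), lintegral_rpow_neg_half_add ht]

lemma katoSup_le {V : ℝ → ℝ} (hV : Measurable V) {t T : ℝ} (ht : 0 < t) (htT : t ≤ T) :
    katoSup V t ≤ ENNReal.ofReal (4 * t ^ (1 / 2 : ℝ)) * heatConst V T := by
  rw [katoSup_eq_iSup_heat]
  refine iSup_le fun x => lintegral_heat_le hV ht (u := fun s => s) fun s hs => ?_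
  have h2 : 0 < t - s := sub_pos.2 hs.2
  exact ⟨hs.1, hs.2.le.trans htT, le_add_of_nonneg_right (by positivity)⟩

lemma normS_le {V : ℝ → ℝ} (hV : Measurable V) {t T : ℝ} (htT : t ≤ T) :
    normS V t ≤ ENNReal.ofReal (4 * t ^ (1 / 2 : ℝ)) * heatConst V T := by
  refine iSup₂_le fun r hr => iSup₂_le fun x y => ?_
  rw [S_eq_lintegral_heat]
  refine (lintegral_heat_le (T := T) hV hr.1 fun s hs => ?_).trans ?_
  · have h1 : 0 < s := hs.1
    have h2 : 0 < r - s := sub_pos.2 hs.2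
    have hr0 : 0 < r := hr.1
    refine ⟨by positivity, ?_, rpow_neg_half_bridge_le hs.1 hs.2⟩
    refine le_trans ?_ (hr.2.trans htT)
    rw [div_le_iff₀ hr0]
    nlinarith [hs.2]
  · have hr0 : 0 < r := hr.1
    have := hr.2
    gcongr

lemma tendsto_zero_of_le_sqrt_mul {f : ℝ → ℝ≥0∞} {C : ℝ≥0∞} (hC : C < ∞)
    (hf : ∀ t : ℝ, 0 < t → t ≤ 1 → f t ≤ ENNReal.ofReal (4 * t ^ (1 / 2 : ℝ)) * C) :
    Tendsto f (𝓝[>] 0) (𝓝 0) := by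
  have hlim : Tendsto (fun t : ℝ => ENNReal.ofReal (4 * t ^ (1 / 2 : ℝ)) * C)
      (𝓝[>] 0) (𝓝 0) := by
    have h1 : Continuous fun t : ℝ => 4 * t ^ (1 / 2 : ℝ) :=
      continuous_const.mul (Real.continuous_rpow_const (by norm_num))
    have h2 : Tendsto (fun t : ℝ => ENNReal.ofReal (4 * t ^ (1 / 2 : ℝ))) (𝓝[>] 0) (𝓝 0) := by
      have := ((ENNReal.continuous_ofReal.comp h1).tendsto 0).mono_left
        (nhdsWithin_le_nhds (s := Ioi 0))
      simpa [Function.comp_def] using this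
    simpa using ENNReal.Tendsto.mul_const h2 (Or.inr hC.ne)
  refine tendsto_of_tendsto_of_tendsto_of_le_of_le' tendsto_const_nhds hlim
    (Eventually.of_forall fun _ => zero_le) ?_
  filter_upwards [Ioc_mem_nhdsGT (zero_lt_one' ℝ)] with t ht
  exact hf t ht.1 ht.2

/-! ### Lower bounds -/

/-- The prefactor is smallest at time `b`, the exponential at time `a`. -/
lemma le_gauss {a b u m z : ℝ} (ha : 0 < a) (hau : a ≤ u) (hub : u ≤ b) (hz : |z - m| ≤ 1) :
    (4 * Real.pi * b) ^ (-(1 / 2) : ℝ) * Real.exp (-1 / (4 * a)) ≤ gauss u m z := by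
  have hu : 0 < u := ha.trans_le hau
  rw [gauss_eq]
  gcongr ?_ * Real.exp ?_
  · exact Real.rpow_le_rpow_of_nonpos (by positivity) (by gcongr) (by norm_num)
  · rw [neg_div, neg_div, neg_le_neg_iff]
    gcongr
    exact (sq_le_one_iff_abs_le_one _).2 hz

/-- If the time parameter of `heat` stays in `[a,b]` for `s ∈ (p,q)`, then `heat` controls the
integrals of `|V|` over intervals of length two. -/
lemma locNorm_lt_top {V : ℝ → ℝ} {a b p q t : ℝ} {K : ℝ≥0∞} (ha : 0 < a) (hab : a ≤ b)
    (hpq : p < q) (hp : 0 ≤ p) (hq : q ≤ t) {u : ℝ → ℝ}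
    (hu : ∀ s ∈ Ioo p q, a ≤ u s ∧ u s ≤ b) (hK : K < ∞)
    (h : ∀ x, ∫⁻ s in Ioo 0 t, heat V (u s) x ≤ K) : locNorm V < ∞ := by
  set c : ℝ := (4 * Real.pi * b) ^ (-(1 / 2) : ℝ) * Real.exp (-1 / (4 * a)) with hc
  have hb : 0 < b := ha.trans_le hab
  have hc0 : 0 < c := by positivity
  set d : ℝ≥0∞ := ENNReal.ofReal c * ENNReal.ofReal (q - p) with hd
  have hd0 : d ≠ 0 := by
    simp only [hd, ne_eq, mul_eq_zero, ENNReal.ofReal_eq_zero, not_or, not_le]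
    exact ⟨hc0, sub_pos.2 hpq⟩
  have hdt : d ≠ ∞ := ENNReal.mul_ne_top ENNReal.ofReal_ne_top ENNReal.ofReal_ne_top
  refine lt_of_le_of_lt (b := K / d) (iSup_le fun x => ?_) (ENNReal.div_lt_top hK.ne hd0)
  rw [ENNReal.le_div_iff_mul_le (Or.inl hd0) (Or.inl hdt)]
  refine le_trans ?_ (h x)
  have hm : MeasurableSet {z : ℝ | |z - x| ≤ 1} :=
    measurableSet_le (by fun_prop) measurable_const
  set A : ℝ≥0∞ := ∫⁻ z in {z : ℝ | |z - x| ≤ 1}, ENNReal.ofReal |V z| with hA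
  calc A * d = ∫⁻ _ in Ioo p q, ENNReal.ofReal c * A := by
        rw [setLIntegral_const, Real.volume_Ioo, hd]
        ring
    _ ≤ ∫⁻ s in Ioo p q, heat V (u s) x := by
        refine setLIntegral_mono' measurableSet_Ioo fun s hs => ?_
        rw [hA, ← lintegral_const_mul' _ _ ENNReal.ofReal_ne_top]
        refine le_trans (setLIntegral_mono' hm fun z hz => ?_) (setLIntegral_le_lintegral _ _)
        rw [← ENNReal.ofReal_mul hc0.le]
        refine ENNReal.ofReal_le_ofReal ?_
        gcongr
        exact le_gauss ha (hu s hs).1 (hu s hs).2 hz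
    _ ≤ ∫⁻ s in Ioo 0 t, heat V (u s) x :=
        lintegral_mono_set (Ioo_subset_Ioo hp hq)

lemma locNorm_lt_top_of_katoSup {V : ℝ → ℝ} {t : ℝ} (ht : 0 < t) (h : katoSup V t < ∞) :
    locNorm V < ∞ := by
  rw [katoSup_eq_iSup_heat] at h
  refine locNorm_lt_top (a := t / 2) (b := t) (p := t / 2) (q := t) (t := t) (u := fun s => s)
    (by linarith) (by linarith) (by linarith) (by linarith) le_rfl
    (fun s hs => ⟨hs.1.le, hs.2.le⟩) h fun x => ?_
  exact le_iSup (fun x : ℝ => ∫⁻ s in Ioo 0 t, heat V s x) x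

lemma locNorm_lt_top_of_normS {V : ℝ → ℝ} {T : ℝ} (hT : 0 < T) (h : normS V T < ∞) :
    locNorm V < ∞ := by
  -- On `(T/4, T/2)` the bridge time is at least `T/8`; `T/16` leaves room.
  refine locNorm_lt_top (a := T / 16) (b := T) (p := T / 4) (q := T / 2) (t := T)
    (u := fun s => s * (T - s) / T)
    (by linarith) (by linarith) (by linarith) (by linarith) (by linarith)
    (fun s hs => ?_) h fun x => ?_
  · rw [le_div_iff₀ hT, div_le_iff₀ hT]
    constructor <;> nlinarith [hs.1, hs.2]
  -- On the diagonal the bridge centre stays at `x`.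
  · have hS := S_eq_lintegral_heat V T x x
    simp only [sub_self, mul_zero, add_zero] at hS
    rw [← hS]
    calc S V T x x ≤ normSAt V T := le_iSup₂ (f := fun x y : ℝ => S V T x y) x x
      _ ≤ normS V T := le_iSup₂ (f := fun t (_ : t ∈ Ioc 0 T) => normSAt V t) T ⟨hT, le_rfl⟩

lemma exists_pos_lt_top_of_tendsto_zero {f : ℝ → ℝ≥0∞} (hf : Tendsto f (𝓝[>] 0) (𝓝 0)) :
    ∃ t : ℝ, 0 < t ∧ f t < ∞ := by
  have h := hf.eventually (gt_mem_nhds ENNReal.zero_lt_top)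
  obtain ⟨t, ht, ht0⟩ := (h.and self_mem_nhdsWithin).exists
  exact ⟨t, ht0, ht⟩

end SharpGauss

theorem mainTheorem7 (V : ℝ → ℝ) (hV : Measurable V) :
    List.TFAE [
      SharpGauss.KatoClass V,
      SharpGauss.EnlargedKatoClass V,
      ∀ t : ℝ, 0 < t → SharpGauss.katoSup V t < ∞,
      (⨆ x : ℝ, ∫⁻ z in {z : ℝ | |z - x| ≤ 1}, ENNReal.ofReal |V z|) < ∞,
      Tendsto (fun T : ℝ => SharpGauss.normS V T) (𝓝[>] 0) (𝓝 0),
      ∃ T : ℝ, 0 < T ∧ SharpGauss.normS V T < ∞,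
      ∀ T : ℝ, 0 < T → SharpGauss.normS V T < ∞] := by
  have hconst (T : ℝ) (hT : 0 < T) (h : SharpGauss.locNorm V < ∞) :
      ENNReal.ofReal (4 * T ^ (1 / 2 : ℝ)) * SharpGauss.heatConst V T < ∞ :=
    ENNReal.mul_lt_top ENNReal.ofReal_lt_top (SharpGauss.heatConst_lt_top h hT)
  tfae_have 1 → 2 := SharpGauss.exists_pos_lt_top_of_tendsto_zero
  tfae_have 2 → 4 := fun ⟨_, ht, h⟩ => SharpGauss.locNorm_lt_top_of_katoSup ht h
  tfae_have 4 → 3 := fun h t ht => (SharpGauss.katoSup_le hV ht le_rfl).trans_lt (hconst t ht h)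
  tfae_have 3 → 2 := fun h => ⟨1, one_pos, h 1 one_pos⟩
  -- The horizon is fixed at 1, since `heatConst V T` carries the factor `exp(1/(4T))`, which blows
  -- up as `T → 0`.
  tfae_have 4 → 1 := fun h => SharpGauss.tendsto_zero_of_le_sqrt_mul
    (SharpGauss.heatConst_lt_top h one_pos) fun _ ht ht1 => SharpGauss.katoSup_le hV ht ht1
  tfae_have 4 → 5 := fun h => SharpGauss.tendsto_zero_of_le_sqrt_mul
    (SharpGauss.heatConst_lt_top h one_pos) fun _ _ ht1 => SharpGauss.normS_le hV ht1
  tfae_have 5 → 6 := SharpGauss.exists_pos_lt_top_of_tendsto_zero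
  tfae_have 6 → 4 := fun ⟨_, hT, h⟩ => SharpGauss.locNorm_lt_top_of_normS hT h
  tfae_have 4 → 7 := fun h T hT => (SharpGauss.normS_le hV le_rfl).trans_lt (hconst T hT h)
  tfae_have 7 → 6 := fun h => ⟨1, one_pos, h 1 one_pos⟩
  tfae_finish
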